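/- **Setting.** Let $\mathcal M=(S,\mathsf A,\mathsf{Av},\Delta,s_0)$ be a finite Markov decision process: $\mathsf{Av}(s)\neq\emptyset$ is the set of actions enabled in $s$, each action is enabled in exactly one state, $\Delta(a,\cdot)$ is a probability distribution on $S$, and $s_0$ is the initial state. Let $T\subseteq S$ be a set of target states and $\mathbf r:S\to\mathbb Q$ a reward function (only its values on $T$ matter for payoffs). All target states are absorbing, i.e. $\Delta(a,s)=1$ for $s\in T$, $a\in\mathsf{Av}(s)$, and $T$ is reachable from every maximal end component. A strategy $\sigma$ has a countable set of memory elements, an initial memory distribution, a randomised memory update and a randomised next-move function; it is memoryless if the memory is a singleton. It induces a probability measure $\mathbb P^\sigma$ on runs. The payoff $R$ of a run is $\mathbf r(s)$ for the first visited target state $s$, and $0$ if no target state is visited. For $p\in(0,1)$ put $\mathrm{VaR}^\sigma_p=\sup\{r\in\mathbb R\mid \mathbb P^\sigma[R\le r]\le p\}$ and, with $v=\mathrm{VaR}^\sigma_p$, $\mathrm{CVaR}^\sigma_p=\frac1p\big(\int_{\{R<v\}}R\,d\mathbb P^\sigma+(p-\mathbb P^\sigma[R<v])\,v\big)$. The attraction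 assumption is that (A1) $T$ is reached almost surely under every strategy, or (A2) $\mathbf r(s)\ge 0$ for all $s\in T$. For $p\in(0,1)$ and $e,c,t\in\mathbb Q$, let $\mathrm{LP}(t)$ be the following linear program in real variables $y_a$ ($a\in\mathsf A$), $x_s,\underline x_s$ ($s\in S$): 1. all variables are non-negative; 2. $\mathbb 1_{s_0}(s)+\sum_{a\in\mathsf A}y_a\Delta(a,s)=\sum_{a\in\mathsf{Av}(s)}y_a+x_s$ for all $s\in S$; 3. $\sum_{s\in T}x_s=1$; 4. $\underline x_s=x_s$ for $s\in T$ with $\mathbf r(s)<t$, and $\underline x_s\le x_s$ for $s\in T$ with $\mathbf r(s)=t$; 5. $\sum_{s\in T,\ \mathbf r(s)\le t}\underline x_s=p$; 6. $\sum_{s\in T,\ \mathbf r(s)\le t}\underline x_s\,\mathbf r(s)\ge p\,c$ and $\sum_{s\in T}x_s\,\mathbf r(s)\ge e$. **Theorem.** Let $\mathcal M,T,\mathbf r$ be as above and satisfy the attraction assumption, and fix $p\in(0,1)$ and $e,c\in\mathbb Q$. Then: 1. if some strategy $\sigma$ satisfies $\mathbb E^\sigma[R]\ge e$ and $\mathrm{CVaR}^\sigma_p\ge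 c$, then there is $t\in\mathbf r(T)\subseteq\mathbf r(S)$ such that $\mathrm{LP}(t)$ is feasible; 2. for every $t\in\mathbf r(S)$, every solution $(y,x,\underline x)$ of $\mathrm{LP}(t)$ induces a memoryless randomising strategy $\sigma$ with $\mathbb E^\sigma[R]\ge e$, $\mathrm{CVaR}^\sigma_p\ge c$ and $\mathrm{VaR}^\sigma_p\ge t$. Here "induces" means that in each state $s$ with $\sum_{b\in\mathsf{Av}(s)}y_b>0$ the strategy $\sigma$ plays each $a\in\mathsf{Av}(s)$ with probability $y_a/\sum_{b\in\mathsf{Av}(s)}y_b$, and that $\sigma$ reaches each $s\in T$ with probability $x_s$. -/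

import Mathlib

open MeasureTheory ProbabilityTheory

/-! ## Markov chains and their probability space of runs -/

/-- A Markov chain on the state space `X`: transition function and initial distribution. -/
structure MarkovChain (X : Type*) where
  trans : X → PMF X
  init : PMF X

namespace MarkovChain

variable {X : Type*} [Countable X] [MeasurableSpace X] [DiscreteMeasurableSpace X]

/-- The kernel that maps a history `x₀ … xₙ` to the distribution of the next state, which is
`trans xₙ`. -/
noncomputable def stepKernel (C : MarkovChain X) (n : ℕ) :
    Kernel ((i : Finset.Iic n) → (fun _ : ℕ => X) i) X :=
  (Kernel.ofFunOfCountable fun x => (C.trans x).toMeasure).comap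
    (fun h => h ⟨n, Finset.mem_Iic.2 le_rfl⟩) (measurable_pi_apply _)

instance (C : MarkovChain X) (n : ℕ) : IsMarkovKernel (C.stepKernel n) where
  isProbabilityMeasure h := by
    change IsProbabilityMeasure (C.trans (h ⟨n, Finset.mem_Iic.2 le_rfl⟩)).toMeasure
    infer_instance

/-- The probability measure on the runs of a Markov chain (states are indexed from `0`). -/
noncomputable def runMeasure (C : MarkovChain X) : Measure (ℕ → X) :=
  Kernel.trajMeasure (X := fun _ : ℕ => X) C.init.toMeasure C.stepKernel

instance (C : MarkovChain X) : IsProbabilityMeasure C.runMeasure := by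
  unfold runMeasure; infer_instance

/-- The measure of the cone of a path is the product of the probabilities along the path. This
determines `runMeasure`. -/
theorem runMeasure_cone (C : MarkovChain X) (s : ℕ → X) (n : ℕ) :
    C.runMeasure {ω | ∀ i ≤ n, ω i = s i} =
      C.init (s 0) * ∏ i ∈ Finset.range n, C.trans (s i) (s (i + 1)) := by
  classical
  have hcoord : Measurable (Preorder.frestrictLe (π := fun _ : ℕ => X) n) := by fun_prop
  induction n with
  | zero =>
    have hmap : C.runMeasure.map (Preorder.frestrictLe (π := fun _ : ℕ => X) 0) =
        C.init.toMeasure.map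
          (MeasurableEquiv.piUnique fun i : Finset.Iic 0 => (fun _ : ℕ => X) i).symm := by
      rw [runMeasure, Kernel.trajMeasure, Measure.map_comp _ _ (by fun_prop),
        Kernel.traj_map_frestrictLe, Kernel.partialTraj_self, Measure.id_comp]
    have hset : {ω : ℕ → X | ∀ i ≤ 0, ω i = s i} =
        Preorder.frestrictLe (π := fun _ : ℕ => X) 0 ⁻¹'
          {h | h ⟨0, Finset.mem_Iic.2 le_rfl⟩ = s 0} := by
      ext ω; simp
    have hm : MeasurableSet {h : (i : Finset.Iic 0) → (fun _ : ℕ => X) i |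
        h ⟨0, Finset.mem_Iic.2 le_rfl⟩ = s 0} := by
      have hev : Measurable fun h : (i : Finset.Iic 0) → (fun _ : ℕ => X) i =>
          (h ⟨0, Finset.mem_Iic.2 le_rfl⟩ : X) := measurable_pi_apply _
      exact hev (MeasurableSet.of_discrete (s := ({s 0} : Set X)))
    rw [hset, ← Measure.map_apply hcoord hm, hmap, MeasurableEquiv.map_apply]
    have hpre : (MeasurableEquiv.piUnique fun i : Finset.Iic 0 => (fun _ : ℕ => X) i).symm ⁻¹'
        {h | h ⟨0, Finset.mem_Iic.2 le_rfl⟩ = s 0} = {s 0} := by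
      ext x
      simp only [Set.mem_preimage, Set.mem_ofPred_eq, Set.mem_singleton_iff]
      rfl
    rw [hpre]
    simp [PMF.toMeasure_apply_singleton]
  | succ n ih =>
    have ih' := ih (by fun_prop)
    set H : Set ((i : Finset.Iic n) → (fun _ : ℕ => X) i) := {h | ∀ i, h i = s i} with hH
    have hHm : MeasurableSet H := by
      have hev (i : Finset.Iic n) : Measurable fun h : (i : Finset.Iic n) → (fun _ : ℕ => X) i =>
          (h i : X) := measurable_pi_apply i
      have hHi : H = ⋂ i : Finset.Iic n,
          (fun h : (i : Finset.Iic n) → (fun _ : ℕ => X) i => (h i : X)) ⁻¹' {s i} := by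
        ext h; simp [hH]
      rw [hHi]
      exact MeasurableSet.iInter fun i => hev i (MeasurableSet.of_discrete (s := ({s i} : Set X)))
    have hset : {ω : ℕ → X | ∀ i ≤ n + 1, ω i = s i} =
        (fun ω : ℕ → X => (Preorder.frestrictLe (π := fun _ : ℕ => X) n ω, ω (n + 1))) ⁻¹'
          (H ×ˢ {s (n + 1)}) := by
      ext ω
      simp only [hH, Set.mem_ofPred_eq, Set.mem_preimage, Set.mem_prod, Set.mem_singleton_iff,
        Subtype.forall, Finset.mem_Iic, Preorder.frestrictLe_apply]
      constructor
      · intro h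
        exact ⟨fun i hi => h i (by lia), h _ le_rfl⟩
      · rintro ⟨h1, h2⟩ i hi
        rcases Nat.lt_or_ge n i with h | h
        · obtain rfl : i = n + 1 := by lia
          exact h2
        · exact h1 i h
    have hpre : Preorder.frestrictLe (π := fun _ : ℕ => X) n ⁻¹' H =
        {ω : ℕ → X | ∀ i ≤ n, ω i = s i} := by
      ext ω; simp [hH]
    rw [hset, ← Measure.map_apply (by fun_prop) (hHm.prod MeasurableSet.of_discrete)]
    have key := Kernel.map_frestrictLe_trajMeasure_compProd_eq_map_trajMeasure
      (X := fun _ : ℕ => X) (μ₀ := C.init.toMeasure) (κ := C.stepKernel) (a := n)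
    rw [runMeasure, ← key, Measure.compProd_apply_prod hHm MeasurableSet.of_discrete,
      setLIntegral_congr_fun (g := fun _ => C.trans (s n) (s (n + 1))) hHm]
    · rw [setLIntegral_const, Measure.map_apply (by fun_prop) hHm, hpre]
      change _ * C.runMeasure _ = _
      rw [ih', Finset.prod_range_succ]
      ring
    · intro h hh
      change (C.trans (h ⟨n, Finset.mem_Iic.2 le_rfl⟩)).toMeasure {s (n + 1)} = _
      rw [PMF.toMeasure_apply_singleton _ _ MeasurableSet.of_discrete]
      rw [show h ⟨n, Finset.mem_Iic.2 le_rfl⟩ = s n from hh _]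

end MarkovChain

/-! ## Value-at-risk and conditional value-at-risk -/

section Risk

variable {Ω : Type*} [MeasurableSpace Ω]

/-- `VaR_p(X) = sup {r | F_X(r) ≤ p}`, for `p ∈ (0, 1)`. -/
noncomputable def valueAtRisk (P : Measure Ω) (p : ℝ) (X : Ω → ℝ) : ℝ :=
  sSup {r : ℝ | P.real {ω | X ω ≤ r} ≤ p}

/-- `CVaR_p(X) = (1 / p) (∫_{X < v} X dP + (p - P[X < v]) v)` with `v = VaR_p(X)`,
for `p ∈ (0, 1)`. -/
noncomputable def condValueAtRisk (P : Measure Ω) (p : ℝ) (X : Ω → ℝ) : ℝ :=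
  (1 / p) * (∫ ω in {ω | X ω < valueAtRisk P p X}, X ω ∂P +
    (p - P.real {ω | X ω < valueAtRisk P p X}) * valueAtRisk P p X)

end Risk

/-! ## Markov decision processes -/

/-- A Markov decision process with states `S` and actions `A` (both finite wherever it matters).
Each action is enabled in exactly one state. -/
structure MDP (S A : Type*) where
  Av : S → Finset A
  av_nonempty : ∀ s, (Av s).Nonempty
  av_partition : ∀ a, ∃! s, a ∈ Av s
  Δ : A → PMF S
  s₀ : S

/-- States of a play: the current state, the current memory element and the next action. -/
@[ext]
structure PlayState (S 𝕄 A : Type*) where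
  state : S
  mem : 𝕄
  act : A

namespace PlayState

variable {S 𝕄 A : Type*}

instance : MeasurableSpace (PlayState S 𝕄 A) := ⊤

instance : DiscreteMeasurableSpace (PlayState S 𝕄 A) := ⟨fun _ => trivial⟩

instance [Countable S] [Countable 𝕄] [Countable A] : Countable (PlayState S 𝕄 A) :=
  Function.Injective.countable (f := fun z : PlayState S 𝕄 A => (z.state, z.mem, z.act))
    (fun z w h => by
      simp only [Prod.mk.injEq] at h
      exact PlayState.ext h.1 h.2.1 h.2.2)

end PlayState

namespace MDP

variable {S A : Type*}

/-- A strategy with set of memory elements `𝕄`: (stochastic) memory update, next move and initial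
memory distribution. It is memoryless if `𝕄` is a singleton. -/
structure Strategy (M : MDP S A) (𝕄 : Type) where
  update : A → S → 𝕄 → PMF 𝕄
  next : S → 𝕄 → PMF A
  init : PMF 𝕄
  supp_next : ∀ s m, (next s m).support ⊆ ↑(M.Av s)

/-- The play of `M` under `σ`. -/
noncomputable def play (M : MDP S A) {𝕄 : Type} (σ : M.Strategy 𝕄) :
    MarkovChain (PlayState S 𝕄 A) where
  trans z :=
    (M.Δ z.act).bind fun s' => (σ.update z.act s' z.mem).bind fun m' =>
      (σ.next s' m').bind fun a' => PMF.pure ⟨s', m', a'⟩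
  init := σ.init.bind fun m => (σ.next M.s₀ m).bind fun a => PMF.pure ⟨M.s₀, m, a⟩

theorem play_trans_apply (M : MDP S A) {𝕄 : Type} (σ : M.Strategy 𝕄) (z z' : PlayState S 𝕄 A) :
    (M.play σ).trans z z' =
      M.Δ z.act z'.state * σ.update z.act z'.state z.mem z'.mem *
        σ.next z'.state z'.mem z'.act := by
  classical
  obtain ⟨s', m', a'⟩ := z'
  simp only [play, PMF.bind_apply, PMF.pure_apply, PlayState.mk.injEq]
  rw [tsum_eq_single s' (fun b hb => by simp [hb.symm]),
    tsum_eq_single m' (fun b hb => by simp [hb.symm]),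
    tsum_eq_single a' (fun b hb => by simp [hb.symm])]
  simp [mul_assoc]

theorem play_init_apply (M : MDP S A) {𝕄 : Type} (σ : M.Strategy 𝕄) (m : 𝕄) (a : A) :
    (M.play σ).init ⟨M.s₀, m, a⟩ = σ.init m * σ.next M.s₀ m a := by
  classical
  simp only [play, PMF.bind_apply, PMF.pure_apply, PlayState.mk.injEq]
  rw [tsum_eq_single m (fun b hb => by simp [hb.symm]),
    tsum_eq_single a (fun b hb => by simp [hb.symm])]
  simp

/-- The probability measure `ℙ^σ` on the runs of the play of `M` under `σ`. -/
noncomputable def playMeasure [Countable S] [Countable A] (M : MDP S A) {𝕄 : Type} [Countable 𝕄]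
    (σ : M.Strategy 𝕄) : Measure (ℕ → PlayState S 𝕄 A) :=
  (M.play σ).runMeasure

/-- The sequence of states of a run of a play. -/
def stateRun {𝕄 : Type*} (ω : ℕ → PlayState S 𝕄 A) : ℕ → S := fun i => (ω i).state

/-! ### Targets, weighted reachability -/

open Classical in
/-- Weighted reachability of a sequence of states: the reward of the first visited target state,
`0` if there is none. -/
noncomputable def weightedReach (T : Finset S) (r : S → ℚ) (ρ : ℕ → S) : ℝ :=
  if ∃ i, ρ i ∈ T then (r (ρ (sInf {i | ρ i ∈ T})) : ℝ) else 0

/-- All target states are absorbing. -/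
def Absorbing (M : MDP S A) (T : Finset S) : Prop :=
  ∀ s ∈ T, ∀ a ∈ M.Av s, M.Δ a s = 1

section Values

variable [Countable S] [Countable A] (M : MDP S A) {𝕄 : Type} [Countable 𝕄]

/-- The probability under `σ` of eventually reaching a state of `B`. -/
noncomputable def reachProb (σ : M.Strategy 𝕄) (B : Set S) : ℝ :=
  (M.playMeasure σ).real {ω | ∃ i, stateRun ω i ∈ B}

/-- The expected weighted reachability reward under `σ`. -/
noncomputable def expReach (σ : M.Strategy 𝕄) (T : Finset S) (r : S → ℚ) : ℝ :=
  ∫ ω, weightedReach T r (stateRun ω) ∂(M.playMeasure σ)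

/-- The value-at-risk of weighted reachability under `σ`. -/
noncomputable def varReach (σ : M.Strategy 𝕄) (T : Finset S) (r : S → ℚ) (p : ℝ) : ℝ :=
  valueAtRisk (M.playMeasure σ) p fun ω => weightedReach T r (stateRun ω)

/-- The conditional value-at-risk of weighted reachability under `σ`. -/
noncomputable def cvarReach (σ : M.Strategy 𝕄) (T : Finset S) (r : S → ℚ) (p : ℝ) : ℝ :=
  condValueAtRisk (M.playMeasure σ) p fun ω => weightedReach T r (stateRun ω)

/-- `σ` satisfies the expectation constraint `e` and the `CVaR` constraint `(p, c)`. -/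
def Satisfies (σ : M.Strategy 𝕄) (T : Finset S) (r : S → ℚ) (p : ℝ) (e c : ℚ) : Prop :=
  (e : ℝ) ≤ M.expReach σ T r ∧ (c : ℝ) ≤ M.cvarReach σ T r p

end Values

/-- The attraction assumption: the target set is reached almost surely under every strategy, or
no target state has negative reward. (Up to renaming, every countable set of memory elements
lives in `Type`.) -/
def AttractionAssumption [Countable S] [Countable A] (M : MDP S A) (T : Finset S) (r : S → ℚ) :
    Prop :=
  (∀ (𝕄 : Type) [Countable 𝕄] (σ : M.Strategy 𝕄),
      ∀ᵐ ω ∂(M.playMeasure σ), ∃ i, stateRun ω i ∈ T) ∨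
    ∀ s ∈ T, 0 ≤ r s

/-! ### End components -/

/-- One step of a path that uses only states of `C` and actions of `B`. -/
def StepIn (M : MDP S A) (C : Set S) (B : Set A) (s t : S) : Prop :=
  s ∈ C ∧ t ∈ C ∧ ∃ a ∈ B, a ∈ M.Av s ∧ M.Δ a t ≠ 0

/-- `(C, B)` is an end component. -/
def IsEndComponent (M : MDP S A) (E : Set S × Set A) : Prop :=
  E.1.Nonempty ∧ E.2.Nonempty ∧ (∀ a ∈ E.2, ∃ s ∈ E.1, a ∈ M.Av s) ∧
    (∀ a ∈ E.2, ∀ s, M.Δ a s ≠ 0 → s ∈ E.1) ∧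
    ∀ s ∈ E.1, ∀ t ∈ E.1, Relation.ReflTransGen (M.StepIn E.1 E.2) s t

/-- A maximal end component (maximal for componentwise inclusion). -/
def IsMEC (M : MDP S A) (E : Set S × Set A) : Prop :=
  Maximal M.IsEndComponent E

/-- There is a path from `s` to a state of `T`. -/
def CanReach (M : MDP S A) (T : Finset S) (s : S) : Prop :=
  ∃ t ∈ T, Relation.ReflTransGen (M.StepIn Set.univ Set.univ) s t

/-- The target set is reachable from every maximal end component. -/
def MECsReach (M : MDP S A) (T : Finset S) : Prop :=
  ∀ E, M.IsMEC E → ∃ s ∈ E.1, M.CanReach T s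

/-! ### The linear program -/

/-- `(y, x, xl)` is a solution of the linear program for the guess `t` of the value-at-risk.
The variables are `y a`, `x s`, and the lower part `xl s` of `x s`. -/
structure IsLPSolution [Fintype S] [Fintype A] (M : MDP S A) (T : Finset S) (r : S → ℚ)
    (p : ℝ) (e c t : ℚ) (y : A → ℝ) (x xl : S → ℝ) : Prop where
  y_nonneg : ∀ a, 0 ≤ y a
  x_nonneg : ∀ s, 0 ≤ x s
  xl_nonneg : ∀ s, 0 ≤ xl s
  flow : ∀ s, ({M.s₀} : Set S).indicator 1 s + ∑ a, y a * (M.Δ a s).toReal =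
    ∑ a ∈ M.Av s, y a + x s
  switch : ∑ s ∈ T, x s = 1
  split_lt : ∀ s ∈ T, r s < t → xl s = x s
  split_eq : ∀ s ∈ T, r s = t → xl s ≤ x s
  prob_split : ∑ s ∈ T with r s ≤ t, xl s = p
  cvar : p * c ≤ ∑ s ∈ T with r s ≤ t, xl s * r s
  exp : (e : ℝ) ≤ ∑ s ∈ T, x s * r s

/-- The memoryless strategy `σ` is induced by the solution `(y, x)`: in each state with positive
flow it picks the enabled actions proportionally to the flow `y`, and it reaches each target state
`s` with probability `x s`. -/
def Strategy.InducedBy [Countable S] [Countable A] {M : MDP S A} (σ : M.Strategy Unit)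
    (T : Finset S) (y : A → ℝ) (x : S → ℝ) : Prop :=
  (∀ s, 0 < ∑ b ∈ M.Av s, y b →
    ∀ a ∈ M.Av s, (σ.next s () a).toReal = y a / ∑ b ∈ M.Av s, y b) ∧
  ∀ s ∈ T, M.reachProb σ {s} = x s

end MDP

/-! ## Finitely generated cones are closed -/

section Cone

variable {ι E : Type*} [Fintype ι]

/-- Conic Carathéodory theorem: a conic combination can be rewritten with linearly independent
generators. -/
theorem exists_conic_combination_linearIndepOn [AddCommGroup E] [Module ℝ E] (v : ι → E)
    (c : ι → ℝ) (hc : ∀ i, 0 ≤ c i) :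
    ∃ (s : Finset ι) (d : ι → ℝ), LinearIndepOn ℝ v (s : Set ι) ∧ (∀ i, 0 ≤ d i) ∧
      ∑ i ∈ s, d i • v i = ∑ i, c i • v i := by
  classical
  induction hn : (Finset.univ.filter fun i => c i ≠ 0).card using Nat.strong_induction_on
    generalizing c with
  | _ n ih =>
  set s := Finset.univ.filter fun i => c i ≠ 0 with hs
  have hsum (f : ι → ℝ) (hf : ∀ i, i ∉ s → f i = 0) : ∑ i ∈ s, f i • v i = ∑ i, f i • v i :=
    Finset.sum_subset (Finset.subset_univ _) fun i _ hi => by rw [hf i hi, zero_smul]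
  by_cases hli : LinearIndepOn ℝ v (s : Set ι)
  · exact ⟨s, c, hli, hc, hsum c fun i hi => by simpa [hs] using hi⟩
  obtain ⟨g, hg0, i₀, hi₀, hgi₀⟩ : ∃ g : ι → ℝ, ∑ i ∈ s, g i • v i = 0 ∧ ∃ i ∈ s, 0 < g i := by
    rw [linearIndepOn_finset_iff] at hli
    push Not at hli
    obtain ⟨g, hg, i, hi, hgi⟩ := hli
    rcases lt_or_gt_of_ne hgi with h | h
    · exact ⟨fun j => -g j, by simp [Finset.sum_neg_distrib, hg], i, hi, by simpa using h⟩
    · exact ⟨g, hg, i, hi, h⟩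
  obtain ⟨k, hk, hmin⟩ := Finset.exists_min_image (s.filter fun i => 0 < g i)
    (fun i => c i / g i) ⟨i₀, by simp [hi₀, hgi₀]⟩
  simp only [Finset.mem_filter] at hk hmin
  set l := c k / g k with hl
  have hl0 : 0 ≤ l := div_nonneg (hc k) hk.2.le
  set c' : ι → ℝ := fun i => if i ∈ s then c i - l * g i else 0 with hc'
  have hc'0 : ∀ i, 0 ≤ c' i := by
    intro i
    by_cases hi : i ∈ s
    · simp only [hc', hi, if_true]
      rcases le_or_gt (g i) 0 with h | h
      · nlinarith [hc i, mul_nonneg hl0 (neg_nonneg.2 h)]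
      · have := hmin i ⟨hi, h⟩
        rw [le_div_iff₀ h] at this
        linarith
    · simp [hc', hi]
  have hck : c' k = 0 := by
    simp only [hc', hk.1, if_true, hl]
    field_simp [hk.2.ne']
    ring
  have hlt : (Finset.univ.filter fun i => c' i ≠ 0).card < n := by
    rw [← hn]
    refine Finset.card_lt_card (Finset.ssubset_iff_of_subset ?_ |>.2 ⟨k, hk.1, by simp [hck]⟩)
    intro i hi
    by_contra h
    simp [hc', h] at hi
  obtain ⟨s', d, h1, h2, h3⟩ := ih _ hlt c' hc'0 rfl
  refine ⟨s', d, h1, h2, h3.trans ?_⟩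
  rw [← hsum c' fun i hi => by simp [hc', hi], ← hsum c fun i hi => by simpa [hs] using hi]
  calc ∑ i ∈ s, c' i • v i = ∑ i ∈ s, (c i • v i - l • g i • v i) :=
        Finset.sum_congr rfl fun i hi => by simp [hc', hi, sub_smul, mul_smul]
    _ = _ := by rw [Finset.sum_sub_distrib, ← Finset.smul_sum, hg0, smul_zero, sub_zero]

/-- A finitely generated cone in a normed space is closed. -/
theorem isClosed_conic_combinations [NormedAddCommGroup E] [NormedSpace ℝ E]
    (v : ι → E) :
    IsClosed {z | ∃ c : ι → ℝ, (∀ i, 0 ≤ c i) ∧ ∑ i, c i • v i = z} := by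
  classical
  have hset : {z | ∃ c : ι → ℝ, (∀ i, 0 ≤ c i) ∧ ∑ i, c i • v i = z} =
      ⋃ s ∈ {s : Finset ι | LinearIndepOn ℝ v (s : Set ι)},
        (Fintype.linearCombination ℝ fun i : s => v i) '' {c | ∀ i, 0 ≤ c i} := by
    ext z
    simp only [Set.mem_ofPred_eq, Set.mem_iUnion, Set.mem_image, exists_prop]
    constructor
    · rintro ⟨c, hc, rfl⟩
      obtain ⟨s, d, h1, h2, h3⟩ := exists_conic_combination_linearIndepOn v c hc
      refine ⟨s, h1, fun i => d i, fun i => h2 i, ?_⟩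
      rw [Fintype.linearCombination_apply, ← h3, ← Finset.sum_coe_sort s fun i => d i • v i]
    · rintro ⟨s, -, d, hd, rfl⟩
      refine ⟨fun i => if h : i ∈ s then d ⟨i, h⟩ else 0, fun i => ?_, ?_⟩
      · dsimp only
        split_ifs
        exacts [hd _, le_rfl]
      · rw [Fintype.linearCombination_apply, ← Finset.sum_subset (Finset.subset_univ s)
          fun i _ hi => by simp [hi], ← Finset.sum_coe_sort s]
        exact Finset.sum_congr rfl fun i _ => by simp
  rw [hset]
  refine Set.Finite.isClosed_biUnion (Set.toFinite _) fun s hs => ?_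
  have hinj : LinearMap.ker (Fintype.linearCombination ℝ fun i : s => v i) = ⊥ :=
    LinearMap.ker_eq_bot.2 (LinearIndependent.fintypeLinearCombination_injective hs)
  refine (LinearMap.isClosedEmbedding_of_injective hinj).isClosedMap _ ?_
  rw [show {c : s → ℝ | ∀ i, 0 ≤ c i} = ⋂ i, {c | 0 ≤ c i} by ext; simp]
  exact isClosed_iInter fun i => isClosed_le continuous_const (continuous_apply i)

end Cone

/-! ## One-step laws of Markov chains -/

namespace MarkovChain

theorem measurableSet_eval_preimage {X : Type*} [MeasurableSpace X] [DiscreteMeasurableSpace X]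
    (n : ℕ) (B : Set X) : MeasurableSet {ω : ℕ → X | ω n ∈ B} :=
  measurable_pi_apply n (MeasurableSet.of_discrete (s := B))

variable {X : Type*} [Countable X] [MeasurableSpace X] [DiscreteMeasurableSpace X]

theorem runMeasure_eval_zero (C : MarkovChain X) (x : X) :
    C.runMeasure {ω | ω 0 = x} = C.init x := by
  simpa using C.runMeasure_cone (fun _ => x) 0

/-- The joint law of two successive states. -/
theorem runMeasure_eval_succ_mem (C : MarkovChain X) (n : ℕ) (x : X) (B : Set X) :
    C.runMeasure {ω | ω n = x ∧ ω (n + 1) ∈ B} =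
      C.runMeasure {ω | ω n = x} * (C.trans x).toMeasure B := by
  set H : Set ((i : Finset.Iic n) → (fun _ : ℕ => X) i) :=
    {h | h ⟨n, Finset.mem_Iic.2 le_rfl⟩ = x} with hH
  have hHm : MeasurableSet H := by
    have hev : Measurable fun h : (i : Finset.Iic n) → (fun _ : ℕ => X) i =>
        (h ⟨n, Finset.mem_Iic.2 le_rfl⟩ : X) := measurable_pi_apply _
    exact hev (MeasurableSet.of_discrete (s := ({x} : Set X)))
  have hset : {ω : ℕ → X | ω n = x ∧ ω (n + 1) ∈ B} =
      (fun ω : ℕ → X => (Preorder.frestrictLe (π := fun _ : ℕ => X) n ω, ω (n + 1))) ⁻¹'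
        (H ×ˢ B) := by
    ext ω; simp [hH]
  have hpre : Preorder.frestrictLe (π := fun _ : ℕ => X) n ⁻¹' H = {ω : ℕ → X | ω n = x} := by
    ext ω; simp [hH]
  rw [hset, ← Measure.map_apply (by fun_prop) (hHm.prod MeasurableSet.of_discrete)]
  have key := Kernel.map_frestrictLe_trajMeasure_compProd_eq_map_trajMeasure
    (X := fun _ : ℕ => X) (μ₀ := C.init.toMeasure) (κ := C.stepKernel) (a := n)
  rw [runMeasure, ← key, Measure.compProd_apply_prod hHm MeasurableSet.of_discrete,
    setLIntegral_congr_fun (g := fun _ => (C.trans x).toMeasure B) hHm]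
  · rw [setLIntegral_const, Measure.map_apply (by fun_prop) hHm, hpre, mul_comm]
  · intro h hh
    change (C.trans (h ⟨n, Finset.mem_Iic.2 le_rfl⟩)).toMeasure B = _
    rw [show h ⟨n, Finset.mem_Iic.2 le_rfl⟩ = x from hh]

theorem runMeasure_eval_succ (C : MarkovChain X) (n : ℕ) (x y : X) :
    C.runMeasure {ω | ω n = x ∧ ω (n + 1) = y} = C.runMeasure {ω | ω n = x} * C.trans x y := by
  have h := C.runMeasure_eval_succ_mem n x {y}
  rwa [PMF.toMeasure_apply_singleton _ _ MeasurableSet.of_discrete] at h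

theorem runMeasure_eval_eq_tsum (C : MarkovChain X) (n : ℕ) (B : Set X) :
    C.runMeasure {ω | ω n ∈ B} = ∑' x : X, B.indicator (fun x => C.runMeasure {ω | ω n = x}) x := by
  classical
  have h : {ω : ℕ → X | ω n ∈ B} = ⋃ x : X, {ω | ω n = x ∧ x ∈ B} := by
    ext ω; simp
  rw [h, measure_iUnion]
  · refine tsum_congr fun x => ?_
    by_cases hx : x ∈ B <;> simp [hx]
  · intro x y hxy
    refine Set.disjoint_left.2 fun ω h1 h2 => hxy (h1.1.symm.trans h2.1)
  · intro x
    by_cases hx : x ∈ B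
    · simpa [hx] using measurableSet_eval_preimage n {x}
    · simp [hx]

/-- The Chapman–Kolmogorov equation for one step. -/
theorem runMeasure_eval_succ_eq_tsum (C : MarkovChain X) (n : ℕ) (B : Set X) :
    C.runMeasure {ω | ω (n + 1) ∈ B} =
      ∑' x, C.runMeasure {ω | ω n = x} * (C.trans x).toMeasure B := by
  have h : {ω : ℕ → X | ω (n + 1) ∈ B} = ⋃ x : X, {ω | ω n = x ∧ ω (n + 1) ∈ B} := by
    ext ω; simp
  rw [h, measure_iUnion]
  · exact tsum_congr fun x => C.runMeasure_eval_succ_mem n x B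
  · intro x y hxy
    exact Set.disjoint_left.2 fun ω h1 h2 => hxy (h1.1.symm.trans h2.1)
  · intro x
    exact (measurableSet_eval_preimage n {x}).inter (measurableSet_eval_preimage (n + 1) B)

/-- Almost every run takes only transitions of positive probability. -/
theorem ae_trans_ne_zero (C : MarkovChain X) :
    ∀ᵐ ω ∂C.runMeasure, ∀ n, C.trans (ω n) (ω (n + 1)) ≠ 0 := by
  rw [ae_all_iff]
  intro n
  have h : ∀ x y : X, C.trans x y = 0 → ∀ᵐ ω ∂C.runMeasure, ¬(ω n = x ∧ ω (n + 1) = y) := by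
    intro x y hxy
    rw [ae_iff]
    simp only [not_not]
    rw [runMeasure_eval_succ, hxy, mul_zero]
  have h' : ∀ᵐ ω ∂C.runMeasure, ∀ x y : X, C.trans x y = 0 → ¬(ω n = x ∧ ω (n + 1) = y) := by
    simp only [ae_all_iff]
    exact h
  filter_upwards [h'] with ω hω h0
  exact hω _ _ h0 ⟨rfl, rfl⟩

theorem ae_init_ne_zero (C : MarkovChain X) : ∀ᵐ ω ∂C.runMeasure, C.init (ω 0) ≠ 0 := by
  have h : ∀ᵐ ω ∂C.runMeasure, ∀ x : X, C.init x = 0 → ω 0 ≠ x := by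
    simp only [ae_all_iff]
    intro x hx
    rw [ae_iff]
    simp only [ne_eq, not_not]
    rw [runMeasure_eval_zero, hx]
  filter_upwards [h] with ω hω h0
  exact hω _ h0 rfl

end MarkovChain

/-! ## Marginals of a play -/

namespace MDP

theorem measurableSet_state {S A : Type*} {𝕄 : Type} (n : ℕ) (s : S) :
    MeasurableSet {ω : ℕ → PlayState S 𝕄 A | (ω n).state = s} :=
  MarkovChain.measurableSet_eval_preimage n {z : PlayState S 𝕄 A | z.state = s}

theorem measurableSet_act {S A : Type*} {𝕄 : Type} (n : ℕ) (a : A) :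
    MeasurableSet {ω : ℕ → PlayState S 𝕄 A | (ω n).act = a} :=
  MarkovChain.measurableSet_eval_preimage n {z : PlayState S 𝕄 A | z.act = a}

theorem measurableSet_exists_state {S A : Type*} {𝕄 : Type} (s : S) :
    MeasurableSet {ω : ℕ → PlayState S 𝕄 A | ∃ i, stateRun ω i = s} := by
  rw [show {ω : ℕ → PlayState S 𝕄 A | ∃ i, stateRun ω i = s} = ⋃ i, {ω | (ω i).state = s} by
    ext; simp [stateRun]]
  exact MeasurableSet.iUnion fun i => measurableSet_state i s

section Marginals

variable {S A : Type*} (M : MDP S A) {𝕄 : Type}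

theorem mem_Av_of_play_init_ne_zero (σ : M.Strategy 𝕄) {z : PlayState S 𝕄 A}
    (h : (M.play σ).init z ≠ 0) : z.state = M.s₀ ∧ z.act ∈ M.Av z.state := by
  rw [← PMF.mem_support_iff] at h
  simp only [play, PMF.mem_support_bind_iff, PMF.mem_support_pure_iff] at h
  obtain ⟨m, -, a, ha, rfl⟩ := h
  exact ⟨rfl, σ.supp_next _ _ ha⟩

theorem mem_Av_of_play_trans_ne_zero (σ : M.Strategy 𝕄) {z z' : PlayState S 𝕄 A}
    (h : (M.play σ).trans z z' ≠ 0) : M.Δ z.act z'.state ≠ 0 ∧ z'.act ∈ M.Av z'.state := by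
  rw [play_trans_apply] at h
  simp only [mul_ne_zero_iff] at h
  exact ⟨h.1.1, σ.supp_next _ _ h.2⟩

theorem play_trans_map_state (σ : M.Strategy 𝕄) (z : PlayState S 𝕄 A) :
    ((M.play σ).trans z).map PlayState.state = M.Δ z.act := by
  simp [play, PMF.map_bind, PMF.pure_map]

theorem av_unique {a : A} {s s' : S} (h : a ∈ M.Av s) (h' : a ∈ M.Av s') : s = s' :=
  (M.av_partition a).unique h h'

variable [Countable S] [Countable A] [Countable 𝕄] (σ : M.Strategy 𝕄)

instance : IsProbabilityMeasure (M.playMeasure σ) := by unfold playMeasure; infer_instance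

theorem ae_act_mem_Av : ∀ᵐ ω ∂M.playMeasure σ, ∀ n, (ω n).act ∈ M.Av (ω n).state := by
  filter_upwards [(M.play σ).ae_init_ne_zero, (M.play σ).ae_trans_ne_zero] with ω h0 h n
  cases n with
  | zero => exact (M.mem_Av_of_play_init_ne_zero σ h0).2
  | succ n => exact (M.mem_Av_of_play_trans_ne_zero σ (h n)).2

theorem ae_state_zero : ∀ᵐ ω ∂M.playMeasure σ, (ω 0).state = M.s₀ := by
  filter_upwards [(M.play σ).ae_init_ne_zero] with ω h0
  exact (M.mem_Av_of_play_init_ne_zero σ h0).1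

theorem ae_absorbed {T : Finset S} (hT : M.Absorbing T) :
    ∀ᵐ ω ∂M.playMeasure σ, ∀ s ∈ T, ∀ n, stateRun ω n = s → stateRun ω (n + 1) = s := by
  filter_upwards [M.ae_act_mem_Av σ, (M.play σ).ae_trans_ne_zero] with ω ha h s hs n hn
  change (ω n).state = s at hn
  have h1 := (M.mem_Av_of_play_trans_ne_zero σ (h n)).1
  have h2 := hT s hs (ω n).act (hn ▸ ha n)
  rw [PMF.apply_eq_one_iff] at h2
  rw [← PMF.mem_support_iff, h2] at h1
  exact h1

/-- The probability of being in state `s` at time `n`. -/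
noncomputable def stateProb (n : ℕ) (s : S) : ℝ := (M.playMeasure σ).real {ω | (ω n).state = s}

/-- The probability of playing action `a` at time `n`. -/
noncomputable def actProb (n : ℕ) (a : A) : ℝ := (M.playMeasure σ).real {ω | (ω n).act = a}

theorem stateProb_nonneg (n : ℕ) (s : S) : 0 ≤ M.stateProb σ n s := measureReal_nonneg

theorem actProb_nonneg (n : ℕ) (a : A) : 0 ≤ M.actProb σ n a := measureReal_nonneg

theorem stateProb_zero (s : S) : M.stateProb σ 0 s = ({M.s₀} : Set S).indicator 1 s := by
  classical
  by_cases h : s = M.s₀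
  · subst h
    rw [stateProb, measureReal_congr (t := Set.univ)]
    · simp
    · filter_upwards [M.ae_state_zero σ] with ω hω
      exact propext ⟨fun _ => trivial, fun _ => hω⟩
  · rw [stateProb, measureReal_congr (t := ∅)]
    · simp [h]
    · filter_upwards [M.ae_state_zero σ] with ω hω
      exact propext ⟨fun h' => h (h'.symm.trans hω), fun h => h.elim⟩

theorem sum_stateProb [Fintype S] (n : ℕ) : ∑ s, M.stateProb σ n s = 1 := by
  have h := measureReal_biUnion_finset (μ := M.playMeasure σ) (s := Finset.univ)
    (f := fun s => {ω | (ω n).state = s})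
    (fun s _ s' _ hs => Set.disjoint_left.2 fun ω h1 h2 => hs (h1.symm.trans h2))
    (fun s _ => measurableSet_state n s)
  rw [show (⋃ s ∈ Finset.univ, {ω : ℕ → PlayState S 𝕄 A | (ω n).state = s}) = Set.univ by
    ext; simp] at h
  simpa [stateProb] using h.symm

theorem stateProb_eq_sum_actProb (n : ℕ) (s : S) :
    M.stateProb σ n s = ∑ a ∈ M.Av s, M.actProb σ n a := by
  have h := measureReal_biUnion_finset (μ := M.playMeasure σ) (s := M.Av s)
    (f := fun a => {ω | (ω n).act = a})
    (fun s _ s' _ hs => Set.disjoint_left.2 fun ω h1 h2 => hs (h1.symm.trans h2))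
    (fun a _ => measurableSet_act n a)
  simp only [actProb]
  rw [← h, stateProb]
  refine measureReal_congr ?_
  filter_upwards [M.ae_act_mem_Av σ] with ω hω
  refine propext ?_
  change (ω n).state = s ↔ ω ∈ ⋃ a ∈ M.Av s, {ω | (ω n).act = a}
  simp only [Set.mem_iUnion, Set.mem_ofPred_eq, exists_prop, exists_eq_right']
  exact ⟨fun h => h ▸ hω n, fun h => M.av_unique (hω n) h⟩

theorem playMeasure_state_succ (n : ℕ) (s : S) :
    M.playMeasure σ {ω | (ω (n + 1)).state = s} =
      ∑' z, M.playMeasure σ {ω | ω n = z} * M.Δ z.act s := by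
  refine ((M.play σ).runMeasure_eval_succ_eq_tsum n {z | z.state = s}).trans
    (tsum_congr fun z => ?_)
  congr 1
  let _ : MeasurableSpace S := ⊤
  rw [← M.play_trans_map_state σ z, ← PMF.toMeasure_apply_singleton _ _ MeasurableSet.of_discrete,
    PMF.toMeasure_map_apply _ _ _ measurable_from_top MeasurableSet.of_discrete]
  rfl

theorem stateProb_succ [Fintype A] (n : ℕ) (s : S) :
    M.stateProb σ (n + 1) s = ∑ a, M.actProb σ n a * (M.Δ a s).toReal := by
  classical
  have h : M.playMeasure σ {ω | (ω (n + 1)).state = s} =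
      ∑ a, M.playMeasure σ {ω | (ω n).act = a} * M.Δ a s := by
    rw [playMeasure_state_succ]
    have h1 (a : A) : M.playMeasure σ {ω | (ω n).act = a} =
        ∑' z, if z.act = a then M.playMeasure σ {ω | ω n = z} else 0 := by
      refine ((M.play σ).runMeasure_eval_eq_tsum n {z | z.act = a}).trans (tsum_congr fun z => ?_)
      simp only [Set.indicator_apply, Set.mem_ofPred_eq]
      rfl
    simp_rw [h1, ← ENNReal.tsum_mul_right]
    rw [← Summable.tsum_finsetSum fun _ _ => ENNReal.summable]
    refine tsum_congr fun z => ?_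
    simp [ite_mul]
  simp only [stateProb, actProb, Measure.real]
  rw [h, ENNReal.toReal_sum fun a _ => ENNReal.mul_ne_top (measure_ne_top _ _) (PMF.apply_ne_top _ _)]
  simp [ENNReal.toReal_mul]

theorem actProb_eq_of_memoryless (σ : M.Strategy Unit) (n : ℕ) {s : S} {a : A} (ha : a ∈ M.Av s) :
    M.actProb σ n a = M.stateProb σ n s * (σ.next s () a).toReal := by
  have h1 : M.playMeasure σ {ω | (ω n).act = a} = M.playMeasure σ {ω | ω n = ⟨s, (), a⟩} := by
    refine measure_congr ?_
    filter_upwards [M.ae_act_mem_Av σ] with ω hω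
    refine propext ⟨fun h => ?_, fun h => ?_⟩
    · change (ω n).act = a at h
      exact PlayState.ext (M.av_unique (h ▸ hω n) ha) rfl h
    · change ω n = _ at h
      change (ω n).act = a
      rw [h]
  have h2 : M.playMeasure σ {ω | ω n = ⟨s, (), a⟩} =
      M.playMeasure σ {ω | (ω n).state = s} * σ.next s () a := by
    cases n with
    | zero =>
      have h3 := (M.play σ).runMeasure_eval_zero ⟨s, (), a⟩
      change M.playMeasure σ _ = _ at h3
      rw [h3]
      have h5 : ∀ u : Unit, σ.init u = 1 := fun u => by
        have := σ.init.tsum_coe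
        simpa [tsum_fintype] using this
      by_cases hs : s = M.s₀
      · subst hs
        have h4 : M.playMeasure σ {ω | (ω 0).state = M.s₀} = 1 := by
          rw [← prob_compl_eq_zero_iff (measurableSet_state 0 _)]
          exact M.ae_state_zero σ
        rw [play_init_apply, h4, h5]
      · have h4 : M.playMeasure σ {ω | (ω 0).state = s} = 0 := by
          have : ∀ᵐ ω ∂M.playMeasure σ, ¬ (ω 0).state = s := by
            filter_upwards [M.ae_state_zero σ] with ω h h'
            exact hs (h'.symm.trans h)
          simpa [ae_iff] using this
        rw [h4, zero_mul]
        by_contra h6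
        exact hs (M.mem_Av_of_play_init_ne_zero σ h6).1
    | succ n =>
      rw [playMeasure_state_succ, ← ENNReal.tsum_mul_right]
      refine ((M.play σ).runMeasure_eval_succ_eq_tsum n {⟨s, (), a⟩}).trans
        (tsum_congr fun z => ?_)
      have h5 : ∀ u : Unit, σ.update z.act s z.mem u = 1 := fun u => by
        have := (σ.update z.act s z.mem).tsum_coe
        simpa [tsum_fintype] using this
      rw [PMF.toMeasure_apply_singleton _ _ MeasurableSet.of_discrete, play_trans_apply, h5, mul_one, mul_assoc]
      rfl
  simp only [stateProb, actProb, Measure.real]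
  rw [h1, h2, ENNReal.toReal_mul]

/-- The law of the state after `n` steps differs from the initial one by a conic combination of
the effects of the actions. -/
theorem stateProb_sub_eq [Fintype A] [DecidableEq A] (n : ℕ) (s : S) :
    M.stateProb σ n s - ({M.s₀} : Set S).indicator 1 s =
      ∑ a, (∑ k ∈ Finset.range n, M.actProb σ k a) *
        ((M.Δ a s).toReal - if a ∈ M.Av s then 1 else 0) := by
  have h (k : ℕ) : M.stateProb σ (k + 1) s - M.stateProb σ k s =
      ∑ a, M.actProb σ k a * ((M.Δ a s).toReal - if a ∈ M.Av s then 1 else 0) := by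
    rw [stateProb_succ, stateProb_eq_sum_actProb]
    simp [mul_sub, Finset.sum_ite_mem]
  rw [← M.stateProb_zero σ, ← Finset.sum_range_sub (fun k => M.stateProb σ k s)]
  simp_rw [h, Finset.sum_mul]
  rw [Finset.sum_comm]

end Marginals

end MDP

/-! ## The law of weighted reachability -/

namespace MDP

theorem eq_of_le_of_absorbed {S : Type*} {T : Finset S} {ρ : ℕ → S}
    (h : ∀ s ∈ T, ∀ n, ρ n = s → ρ (n + 1) = s) {s : S} (hs : s ∈ T) {m n : ℕ} (hm : ρ m = s)
    (hmn : m ≤ n) : ρ n = s := by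
  induction n, hmn using Nat.le_induction with
  | base => exact hm
  | succ n _ ih => exact h s hs n ih

open Classical in
theorem apply_weightedReach {S : Type*} {T : Finset S} (r : S → ℚ) {ρ : ℕ → S}
    (h : ∀ s ∈ T, ∀ n, ρ n = s → ρ (n + 1) = s) (g : ℝ → ℝ) :
    g (weightedReach T r ρ) =
      g 0 + ∑ s ∈ T, if ∃ i, ρ i = s then g (r s) - g 0 else 0 := by
  by_cases hρ : ∃ i, ρ i ∈ T
  · rw [weightedReach, if_pos hρ]
    have hmem : ρ (sInf {i | ρ i ∈ T}) ∈ T := Nat.sInf_mem (s := {i | ρ i ∈ T}) hρ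
    set k := sInf {i | ρ i ∈ T}
    rw [Finset.sum_eq_single_of_mem _ hmem, if_pos ⟨k, rfl⟩]
    · ring
    · rintro s hs hne
      refine if_neg ?_
      rintro ⟨i, hi⟩
      have h1 := eq_of_le_of_absorbed h hs hi (le_max_left i k)
      have h2 := eq_of_le_of_absorbed h hmem rfl (le_max_right i k)
      exact hne (h1.symm.trans h2)
  · rw [weightedReach, if_neg hρ, Finset.sum_eq_zero, add_zero]
    intro s hs
    refine if_neg ?_
    rintro ⟨i, rfl⟩
    exact hρ ⟨i, hs⟩

section Law

variable {S A : Type*} (M : MDP S A) {𝕄 : Type} [Countable S] [Countable A] [Countable 𝕄]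
  (σ : M.Strategy 𝕄) {T : Finset S}

/-- The expectation of a function of the payoff. -/
theorem integral_apply_weightedReach (hT : M.Absorbing T) (r : S → ℚ) (g : ℝ → ℝ) :
    ∫ ω, g (weightedReach T r (stateRun ω)) ∂M.playMeasure σ =
      g 0 + ∑ s ∈ T, M.reachProb σ {s} * (g (r s) - g 0) := by
  classical
  have h : (fun ω => g (weightedReach T r (stateRun ω))) =ᵐ[M.playMeasure σ] fun ω =>
      g 0 + ∑ s ∈ T, {ω : ℕ → PlayState S 𝕄 A | ∃ i, stateRun ω i = s}.indicator
        (fun _ => g (r s) - g 0) ω := by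
    filter_upwards [M.ae_absorbed σ hT] with ω hω
    rw [apply_weightedReach r hω g]
    rfl
  have hi (s : S) : Integrable ({ω : ℕ → PlayState S 𝕄 A | ∃ i, stateRun ω i = s}.indicator
      (fun _ => g (r s) - g 0)) (M.playMeasure σ) :=
    (integrable_const _).indicator (measurableSet_exists_state s)
  rw [integral_congr_ae h, integral_add (integrable_const _) (integrable_finsetSum _ fun s _ => hi s),
    integral_finsetSum _ fun s _ => hi s]
  simp only [integral_const, probReal_univ, smul_eq_mul, one_mul]
  congr 1
  refine Finset.sum_congr rfl fun s _ => ?_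
  rw [integral_indicator_const _ (measurableSet_exists_state s), smul_eq_mul]
  rfl

theorem integrable_weightedReach (hT : M.Absorbing T) (r : S → ℚ) :
    Integrable (fun ω => weightedReach T r (stateRun ω)) (M.playMeasure σ) := by
  classical
  have h : Integrable (fun ω => ∑ s ∈ T,
      {ω : ℕ → PlayState S 𝕄 A | ∃ i, stateRun ω i = s}.indicator (fun _ => (r s : ℝ)) ω)
      (M.playMeasure σ) :=
    integrable_finsetSum _ fun s _ => (integrable_const _).indicator (measurableSet_exists_state s)
  refine h.congr ?_
  filter_upwards [M.ae_absorbed σ hT] with ω hω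
  have := apply_weightedReach r hω id
  simp only [id, zero_add, sub_zero] at this
  rw [this]
  rfl

theorem tendsto_stateProb (hT : M.Absorbing T) {s : S} (hs : s ∈ T) :
    Filter.Tendsto (fun n => M.stateProb σ n s) Filter.atTop (nhds (M.reachProb σ {s})) := by
  have hmono : Monotone fun n : ℕ => {ω : ℕ → PlayState S 𝕄 A | ∃ i ≤ n, stateRun ω i = s} :=
    fun m n hmn ω ⟨i, hi, h⟩ => ⟨i, hi.trans hmn, h⟩
  have h := tendsto_measure_iUnion_atTop (μ := M.playMeasure σ) hmono
  have hU : (⋃ n : ℕ, {ω : ℕ → PlayState S 𝕄 A | ∃ i ≤ n, stateRun ω i = s}) =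
      {ω | ∃ i, stateRun ω i ∈ ({s} : Set S)} := by
    ext ω
    simp only [Set.mem_iUnion, Set.mem_ofPred_eq, Set.mem_singleton_iff]
    exact ⟨fun ⟨_, i, _, h⟩ => ⟨i, h⟩, fun ⟨i, h⟩ => ⟨i, i, le_rfl, h⟩⟩
  rw [hU] at h
  refine ((ENNReal.tendsto_toReal (measure_ne_top _ _)).comp h).congr fun n => ?_
  refine congrArg ENNReal.toReal (measure_congr ?_)
  filter_upwards [M.ae_absorbed σ hT] with ω hω
  refine propext ⟨?_, fun h => ⟨n, le_rfl, h⟩⟩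
  rintro ⟨i, hi, h⟩
  exact eq_of_le_of_absorbed hω hs h hi

end Law

end MDP

/-! ## Risk functionals -/

section Risk

variable {Ω : Type*} [MeasurableSpace Ω] {P : Measure Ω} {X : Ω → ℝ} {p : ℝ}

/-- Rockafellar–Uryasev form of the conditional value-at-risk. -/
theorem mul_condValueAtRisk [IsProbabilityMeasure P] (hX : Integrable X P) (hp : p ≠ 0) :
    p * condValueAtRisk P p X =
      p * valueAtRisk P p X - ∫ ω, max (valueAtRisk P p X - X ω) 0 ∂P := by
  set v := valueAtRisk P p X with hv
  have hm : NullMeasurableSet {ω | X ω < v} P :=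
    nullMeasurableSet_lt hX.aemeasurable aemeasurable_const
  have h1 : ∫ ω, max (v - X ω) 0 ∂P = ∫ ω in {ω | X ω < v}, (v - X ω) ∂P := by
    rw [← integral_indicator₀ hm]
    refine integral_congr_ae (Filter.Eventually.of_forall fun ω => ?_)
    by_cases h : X ω < v
    · simp [Set.indicator, h, h.le]
    · simp [Set.indicator, h, not_lt.1 h]
  have h2 : ∫ ω in {ω | X ω < v}, (v - X ω) ∂P =
      P.real {ω | X ω < v} * v - ∫ ω in {ω | X ω < v}, X ω ∂P := by
    rw [integral_sub (integrable_const _) hX.integrableOn]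
    simp
  rw [h1, h2, condValueAtRisk, ← hv]
  field_simp
  ring

theorem measureReal_mem_eq_integral_indicator [IsProbabilityMeasure P] (hX : AEMeasurable X P)
    {B : Set ℝ} (hB : MeasurableSet B) :
    P.real {ω | X ω ∈ B} = ∫ ω, B.indicator 1 (X ω) ∂P := by
  have h : (fun ω => B.indicator (1 : ℝ → ℝ) (X ω)) = {ω | X ω ∈ B}.indicator 1 := rfl
  have hm : NullMeasurableSet {ω | X ω ∈ B} P := hX.nullMeasurable hB
  rw [h, integral_indicator₀ hm]
  simp

end Risk

namespace MDP

/-! ## Reachability of the target set -/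

section Reach

variable {S A : Type*} (M : MDP S A) {T : Finset S}

/-- If the target set is reachable from every maximal end component, then it is reachable from
every state: a minimal set of reachable states is a maximal end component. -/
theorem canReach_of_MECsReach [Finite S] (h : M.MECsReach T) (s : S) : M.CanReach T s := by
  by_contra hs
  set step := M.StepIn Set.univ Set.univ with hstep
  set R : S → Set S := fun s => {t | Relation.ReflTransGen step s t} with hR
  obtain ⟨u, hu, hmin⟩ := Set.exists_min_image {s | ¬M.CanReach T s} (fun s => (R s).ncard)
    (Set.toFinite _) ⟨s, hs⟩
  have hback : ∀ v ∈ R u, ¬M.CanReach T v := fun v hv ⟨t, ht, hvt⟩ => hu ⟨t, ht, hv.trans hvt⟩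
  have hRv : ∀ v ∈ R u, R v = R u := fun v hv =>
    Set.eq_of_subset_of_ncard_le (fun w hw => hv.trans hw) (hmin v (hback v hv)) (Set.toFinite _)
  have hself : u ∈ R u := Relation.ReflTransGen.refl
  have hsucc : ∀ v ∈ R u, ∀ a ∈ M.Av v, ∀ w, M.Δ a w ≠ 0 → w ∈ R u := fun v hv a ha w hw =>
    Relation.ReflTransGen.tail hv ⟨trivial, trivial, a, trivial, ha, hw⟩
  set B : Set A := {a | ∃ v ∈ R u, a ∈ M.Av v} with hB
  have hEC : M.IsEndComponent (R u, B) := by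
    refine ⟨⟨u, hself⟩, ?_, fun a ha => ha, ?_, ?_⟩
    · obtain ⟨a, ha⟩ := M.av_nonempty u
      exact ⟨a, u, hself, ha⟩
    · rintro a ⟨v, hv, ha⟩ w hw
      exact hsucc v hv a ha w hw
    · intro v hv w hw
      have hvw : Relation.ReflTransGen step v w := by
        have : w ∈ R v := (hRv v hv).symm ▸ hw
        exact this
      clear hw
      induction hvw with
      | refl => exact .refl
      | tail hvx hxy ih =>
        have hx := hv.trans hvx
        obtain ⟨-, -, a, -, ha, hy⟩ := hxy
        exact ih.tail ⟨hx, hsucc _ hx a ha _ hy, a, ⟨_, hx, ha⟩, ha, hy⟩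
  have hMEC : M.IsMEC (R u, B) := by
    refine ⟨hEC, ?_⟩
    rintro ⟨C, D⟩ hCD ⟨hle, -⟩
    have hC : C ⊆ R u := by
      intro w hw
      have hpath := hCD.2.2.2.2 u (hle hself) w hw
      refine Relation.ReflTransGen.mono ?_ u w hpath
      rintro _ _ ⟨-, -, a, -, h1, h2⟩
      exact ⟨trivial, trivial, a, trivial, h1, h2⟩
    refine ⟨hC, fun a ha => ?_⟩
    obtain ⟨v, hv, hav⟩ := hCD.2.2.1 a ha
    exact ⟨v, hC hv, hav⟩
  obtain ⟨v, hv, hvT⟩ := h _ hMEC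
  exact hback v hv hvT

end Reach

/-! ## The cone of flows -/

section Flow

variable {S A : Type*} [Fintype A] (M : MDP S A) {T : Finset S}

/-- The changes of the distribution on states that are caused by a flow through the actions. -/
def flowCone : Set (S → ℝ) :=
  {z | ∃ y : A → ℝ, (∀ a, 0 ≤ y a) ∧
    ∀ s, ∑ a, y a * (M.Δ a s).toReal - ∑ a ∈ M.Av s, y a = z s}

theorem sum_mul_sub_ite [DecidableEq A] (y : A → ℝ) (s : S) :
    ∑ a, y a * ((M.Δ a s).toReal - if a ∈ M.Av s then 1 else 0) =
      ∑ a, y a * (M.Δ a s).toReal - ∑ a ∈ M.Av s, y a := by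
  simp [mul_sub, Finset.sum_ite_mem]

theorem isClosed_flowCone [Fintype S] : IsClosed M.flowCone := by
  classical
  have h : M.flowCone = {z | ∃ c : A → ℝ, (∀ a, 0 ≤ c a) ∧
      ∑ a, c a • (fun s => (M.Δ a s).toReal - if a ∈ M.Av s then 1 else 0) = z} := ?_
  · rw [h]
    exact isClosed_conic_combinations _
  ext z
  simp only [flowCone, Set.mem_ofPred_eq, ← sum_mul_sub_ite]
  refine exists_congr fun y => and_congr_right fun _ => ?_
  rw [funext_iff]
  simp

variable {M}

theorem add_mem_flowCone {z w : S → ℝ} (hz : z ∈ M.flowCone) (hw : w ∈ M.flowCone) :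
    z + w ∈ M.flowCone := by
  obtain ⟨y, hy, hyz⟩ := hz
  obtain ⟨x, hx, hxw⟩ := hw
  refine ⟨y + x, fun a => add_nonneg (hy a) (hx a), fun s => ?_⟩
  simp only [Pi.add_apply, ← hyz, ← hxw, add_mul, Finset.sum_add_distrib]
  ring

theorem smul_mem_flowCone {z : S → ℝ} (hz : z ∈ M.flowCone) {k : ℝ} (hk : 0 ≤ k) :
    k • z ∈ M.flowCone := by
  obtain ⟨y, hy, hyz⟩ := hz
  refine ⟨k • y, fun a => mul_nonneg hk (hy a), fun s => ?_⟩
  simp only [Pi.smul_apply, smul_eq_mul, ← hyz, mul_sub, Finset.mul_sum, mul_assoc]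

theorem _root_.PMF.sum_toReal {α : Type*} [Fintype α] (q : PMF α) : ∑ a, (q a).toReal = 1 := by
  rw [← ENNReal.toReal_sum fun a _ => q.apply_ne_top a, ← tsum_fintype (L := .unconditional α), q.tsum_coe,
    ENNReal.toReal_one]

theorem sum_eq_zero_of_mem_flowCone [Fintype S] {z : S → ℝ} (hz : z ∈ M.flowCone) :
    ∑ s, z s = 0 := by
  classical
  obtain ⟨y, -, hyz⟩ := hz
  have h (a : A) : (Finset.univ.filter fun s => a ∈ M.Av s).card = 1 := by
    obtain ⟨s, hs, hu⟩ := M.av_partition a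
    rw [Finset.card_eq_one]
    exact ⟨s, by ext s'; simpa using ⟨hu s', fun h => h ▸ hs⟩⟩
  simp_rw [← hyz, ← sum_mul_sub_ite]
  rw [Finset.sum_comm]
  refine Finset.sum_eq_zero fun a _ => ?_
  rw [← Finset.mul_sum, Finset.sum_sub_distrib, PMF.sum_toReal, Finset.sum_boole, h]
  simp

theorem action_mem_flowCone [DecidableEq S] {s : S} {a : A} (ha : a ∈ M.Av s) :
    (fun s' => (M.Δ a s').toReal - (Pi.single s 1 : S → ℝ) s') ∈ M.flowCone := by
  classical
  refine ⟨Pi.single a 1, fun b => ?_, fun s' => ?_⟩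
  · by_cases h : b = a
    · subst h; simp
    · simp [h]
  · rw [Finset.sum_eq_single a (fun b _ hb => by simp [hb]) (by simp)]
    simp only [Pi.single_eq_same, one_mul, Finset.sum_pi_single']
    by_cases h : s' = s
    · subst h; simp [ha]
    · have : a ∉ M.Av s' := fun h' => h (M.av_unique h' ha)
      simp [h, this]

/-- If the target set is reachable, some flow moves a positive amount of mass there. -/
theorem CanReach.exists_flow [DecidableEq S] {s : S} (h : M.CanReach T s) :
    ∃ q : S → ℝ, (∀ s, 0 ≤ q s) ∧ q - Pi.single s 1 ∈ M.flowCone ∧ ∃ t ∈ T, 0 < q t := by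
  obtain ⟨t, ht, hst⟩ := h
  have hsingle (s s' : S) : (0 : ℝ) ≤ (Pi.single s 1 : S → ℝ) s' := by
    by_cases h : s' = s
    · subst h; simp
    · simp [h]
  induction hst using Relation.ReflTransGen.head_induction_on with
  | refl => exact ⟨Pi.single t 1, hsingle t, ⟨0, by simp⟩, t, ht, by simp⟩
  | @head s s' hstep _ ih =>
    obtain ⟨-, -, a, -, ha, hs'⟩ := hstep
    obtain ⟨q, hq0, hq, t', ht', hqt'⟩ := ih
    set d := (M.Δ a s').toReal with hd
    have hd0 : 0 < d := ENNReal.toReal_pos hs' (PMF.apply_ne_top _ _)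
    have hle (u : S) : d * (Pi.single s' 1 : S → ℝ) u ≤ (M.Δ a u).toReal := by
      by_cases h : u = s'
      · subst h; simp [hd]
      · simp [h]
    refine ⟨(fun u => (M.Δ a u).toReal) + d • (q - Pi.single s' 1), fun u => ?_, ?_, t', ht', ?_⟩
    · simp only [Pi.add_apply, Pi.smul_apply, Pi.sub_apply, smul_eq_mul]
      nlinarith [hle u, mul_nonneg hd0.le (hq0 u)]
    · convert add_mem_flowCone (action_mem_flowCone ha) (smul_mem_flowCone hq hd0.le) using 1
      ext u
      simp only [Pi.add_apply, Pi.sub_apply]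
      ring
    · simp only [Pi.add_apply, Pi.smul_apply, Pi.sub_apply, smul_eq_mul]
      nlinarith [hle t', mul_pos hd0 hqt']

/-- Every strategy is dominated by a finite flow that reaches the target set with
probability one. -/
theorem exists_flow_ge_reachProb [Fintype S] (hT : M.Absorbing T) (hreach : M.MECsReach T)
    {𝕄 : Type} [Countable 𝕄] (σ : M.Strategy 𝕄) :
    ∃ q : S → ℝ, (∀ s, 0 ≤ q s) ∧ (∀ s ∉ T, q s = 0) ∧ ∑ s ∈ T, q s = 1 ∧
      q - ({M.s₀} : Set S).indicator 1 ∈ M.flowCone ∧ ∀ s ∈ T, M.reachProb σ {s} ≤ q s := by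
  classical
  set K : Set (S → ℝ) := stdSimplex ℝ S ∩
    ({q | q - ({M.s₀} : Set S).indicator 1 ∈ M.flowCone} ∩
      {q | ∀ s ∈ T, M.reachProb σ {s} ≤ q s})
  have hclosed : IsClosed {q : S → ℝ | q - ({M.s₀} : Set S).indicator 1 ∈ M.flowCone} :=
    M.isClosed_flowCone.preimage (continuous_id.sub continuous_const)
  have hcompact : IsCompact K := by
    refine (isCompact_stdSimplex ℝ S).inter_right (hclosed.inter ?_)
    rw [show {q : S → ℝ | ∀ s ∈ T, M.reachProb σ {s} ≤ q s} =
      ⋂ s ∈ T, {q | M.reachProb σ {s} ≤ q s} by ext; simp]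
    exact isClosed_biInter fun s _ => isClosed_le continuous_const (continuous_apply s)
  have hne : K.Nonempty := by
    obtain ⟨q, hq, φ, hφ, hlim⟩ := (isCompact_stdSimplex ℝ S).tendsto_subseq
      (x := fun n => M.stateProb σ n) fun n => ⟨M.stateProb_nonneg σ n, M.sum_stateProb σ n⟩
    refine ⟨q, hq, hclosed.mem_of_tendsto hlim (Filter.Eventually.of_forall fun n => ?_),
      fun s hs => ?_⟩
    · refine ⟨fun a => ∑ k ∈ Finset.range (φ n), M.actProb σ k a,
        fun a => Finset.sum_nonneg fun k _ => M.actProb_nonneg σ k a, fun s => ?_⟩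
      rw [← sum_mul_sub_ite, ← stateProb_sub_eq]
      rfl
    · exact (tendsto_nhds_unique ((M.tendsto_stateProb σ hT hs).comp hφ.tendsto_atTop)
        ((tendsto_pi_nhds.1 hlim) s)).le
  obtain ⟨q, ⟨⟨hq0, hq1⟩, hqc, hqρ⟩, hmax⟩ := hcompact.exists_isMaxOn hne
    (f := fun q => ∑ s ∈ T, q s) (by fun_prop)
  have hqT : ∀ s ∉ T, q s = 0 := by
    intro s hs
    by_contra hne
    have hpos : 0 < q s := lt_of_le_of_ne (hq0 s) (Ne.symm hne)
    obtain ⟨q', hq'0, hq'c, t, ht, hqt⟩ := (M.canReach_of_MECsReach hreach s).exists_flow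
    have hT0 : ∀ u ∈ T, (Pi.single s 1 : S → ℝ) u = 0 := fun u hu => by
      have : u ≠ s := fun h => hs (h ▸ hu)
      simp [this]
    have hmem : q + q s • (q' - Pi.single s 1) ∈ K := by
      refine ⟨⟨fun u => ?_, ?_⟩, ?_, fun u hu => ?_⟩
      · simp only [Pi.add_apply, Pi.smul_apply, Pi.sub_apply, smul_eq_mul]
        have h1 := mul_nonneg hpos.le (hq'0 u)
        by_cases h : u = s
        · subst h; simp; nlinarith
        · simp [h]; nlinarith [hq0 u]
      · have h0 := sum_eq_zero_of_mem_flowCone hq'c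
        simp only [Pi.add_apply, Pi.smul_apply, smul_eq_mul, Finset.sum_add_distrib, hq1,
          ← Finset.mul_sum, h0, mul_zero, add_zero]
      · have h0 := add_mem_flowCone hqc (smul_mem_flowCone hq'c hpos.le)
        rwa [sub_add_eq_add_sub] at h0
      · simp only [Pi.add_apply, Pi.smul_apply, Pi.sub_apply, smul_eq_mul, hT0 u hu, sub_zero]
        exact (hqρ u hu).trans (le_add_of_nonneg_right (mul_nonneg hpos.le (hq'0 u)))
    have h1 := hmax hmem
    simp only [Set.mem_ofPred_eq, Pi.add_apply, Pi.smul_apply, Pi.sub_apply, smul_eq_mul,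
      Finset.sum_add_distrib, add_le_iff_nonpos_right, ← Finset.mul_sum] at h1
    rw [Finset.sum_congr rfl fun u hu => by rw [hT0 u hu, sub_zero]] at h1
    have h2 : 0 < ∑ u ∈ T, q' u := Finset.sum_pos' (fun u _ => hq'0 u) ⟨t, ht, hqt⟩
    exact absurd h1 (not_le.2 (mul_pos hpos h2))
  refine ⟨q, hq0, hqT, ?_, hqc, hqρ⟩
  rw [← hq1]
  exact Finset.sum_subset (Finset.subset_univ _) fun s _ hs => hqT s hs

end Flow

end MDP

namespace MDP

/-! ## From strategies to solutions of the linear program -/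

section ToLP

/-- A finite distribution has a `p`-quantile, and the mass below it can be split off. -/
theorem exists_quantile_split {S : Type*} {p : ℝ} (T : Finset S) (r : S → ℚ) {q : S → ℝ} (hq : ∀ s, 0 ≤ q s)
    (hq1 : ∑ s ∈ T, q s = 1) (hp0 : 0 ≤ p) (hp1 : p ≤ 1) :
    ∃ t ∈ r '' (T : Set S), ∃ xl : S → ℝ, (∀ s, 0 ≤ xl s) ∧ (∀ s, xl s ≤ q s) ∧
      (∀ s, r s < t → xl s = q s) ∧ ∑ s ∈ T with r s ≤ t, xl s = p := by
  classical
  have hT : T.Nonempty := by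
    by_contra h
    rw [Finset.not_nonempty_iff_eq_empty] at h
    simp [h] at hq1
  obtain ⟨m, hm, hmax⟩ := T.exists_max_image r hT
  obtain ⟨u, hu, hmin⟩ := (T.filter fun u => p ≤ ∑ s ∈ T with r s ≤ r u, q s).exists_min_image r
    ⟨m, by
      rw [Finset.mem_filter]
      refine ⟨hm, ?_⟩
      rw [Finset.filter_true_of_mem hmax, hq1]
      exact hp1⟩
  simp only [Finset.mem_filter] at hu hmin
  set a := ∑ s ∈ T with r s < r u, q s with ha
  set b := ∑ s ∈ T with r s = r u, q s with hb
  have hsplit (f : S → ℝ) : ∑ s ∈ T with r s ≤ r u, f s =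
      ∑ s ∈ T with r s < r u, f s + ∑ s ∈ T with r s = r u, f s := by
    rw [← Finset.sum_union]
    · congr 1
      ext s
      simp only [Finset.mem_filter, Finset.mem_union, ← and_or_left, le_iff_lt_or_eq]
    · exact Finset.disjoint_filter.2 fun s _ h1 h2 => h1.ne h2
  have hap : a ≤ p := by
    by_contra! h
    have hne : (T.filter fun s => r s < r u).Nonempty := by
      by_contra h'
      rw [Finset.not_nonempty_iff_eq_empty] at h'
      rw [ha, h', Finset.sum_empty] at h
      linarith
    obtain ⟨w, hw, hwmax⟩ := Finset.exists_max_image _ r hne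
    rw [Finset.mem_filter] at hw
    refine absurd (hmin w ⟨hw.1, h.le.trans ?_⟩) (not_le.2 hw.2)
    refine Finset.sum_le_sum_of_subset_of_nonneg (fun s hs => ?_) fun s _ _ => hq s
    exact Finset.mem_filter.2 ⟨(Finset.mem_filter.1 hs).1, hwmax s hs⟩
  have hpb : p ≤ a + b := (hsplit q) ▸ hu.2
  obtain ⟨k, hk0, hk1, hk⟩ : ∃ k : ℝ, 0 ≤ k ∧ k ≤ 1 ∧ a + k * b = p := by
    have hb0 : 0 ≤ b := Finset.sum_nonneg fun s _ => hq s
    rcases hb0.eq_or_lt with h | h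
    · exact ⟨0, le_rfl, zero_le_one, by linarith⟩
    · refine ⟨(p - a) / b, div_nonneg (by linarith) hb0, (div_le_one h).2 (by linarith), ?_⟩
      field_simp
      ring
  refine ⟨r u, ⟨u, hu.1, rfl⟩, fun s => if r s < r u then q s else k * q s, fun s => ?_,
    fun s => ?_, fun s hs => if_pos hs, ?_⟩
  · dsimp only
    split_ifs
    exacts [hq s, mul_nonneg hk0 (hq s)]
  · dsimp only
    split_ifs
    exacts [le_rfl, mul_le_of_le_one_left (hq s) hk1]
  · rw [hsplit, Finset.sum_congr rfl fun s hs => if_pos (Finset.mem_filter.1 hs).2,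
      Finset.sum_congr rfl fun s hs => if_neg (Finset.mem_filter.1 hs).2.not_lt,
      ← Finset.mul_sum, hk]

/-- The average over a part of mass `p` is at least the Rockafellar–Uryasev value. -/
theorem le_sum_mul_of_sum_eq {S : Type*} {T : Finset S} {r : S → ℚ} {p : ℝ} {q xl : S → ℝ} {t : ℚ} (hq : ∀ s, 0 ≤ q s)
    (hxl0 : ∀ s, 0 ≤ xl s) (hxl : ∀ s, xl s ≤ q s) (hsum : ∑ s ∈ T with r s ≤ t, xl s = p)
    (v : ℝ) :
    p * v + ∑ s ∈ T, q s * (-max (v - r s) 0) ≤ ∑ s ∈ T with r s ≤ t, xl s * r s := by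
  have h1 : ∑ s ∈ T with r s ≤ t, xl s * r s =
      p * v + ∑ s ∈ T with r s ≤ t, xl s * (r s - v) := by
    simp_rw [mul_sub]
    rw [Finset.sum_sub_distrib, ← Finset.sum_mul, hsum]
    ring
  rw [h1, add_le_add_iff_left]
  calc ∑ s ∈ T, q s * (-max (v - r s) 0)
      ≤ ∑ s ∈ T with r s ≤ t, q s * (-max (v - r s) 0) := by
        simp only [mul_neg, Finset.sum_neg_distrib, neg_le_neg_iff]
        exact Finset.sum_le_sum_of_subset_of_nonneg (Finset.filter_subset _ _)
          fun s _ _ => mul_nonneg (hq s) (le_max_right _ _)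
    _ ≤ _ := Finset.sum_le_sum fun s _ => by
        have h2 := le_max_left (v - r s : ℝ) 0
        have h3 := le_max_right (v - r s : ℝ) 0
        nlinarith [mul_nonneg (sub_nonneg.2 (hxl s)) h3, mul_nonneg (hxl0 s) (sub_nonneg.2 h2)]

variable {S A : Type*} [Fintype S] [Fintype A] {M : MDP S A} {T : Finset S} {r : S → ℚ} {p : ℝ}

/-- Under the attraction assumption, larger probabilities of reaching the targets give a larger
expectation of every monotone function of the payoff. -/
theorem integral_apply_weightedReach_le (hT : M.Absorbing T)
    (hattr : M.AttractionAssumption T r) {𝕄 : Type} [Countable 𝕄] (σ : M.Strategy 𝕄) {q : S → ℝ}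
    (hq1 : ∑ s ∈ T, q s = 1) (hq : ∀ s ∈ T, M.reachProb σ {s} ≤ q s) {g : ℝ → ℝ}
    (hg : Monotone g) :
    ∫ ω, g (weightedReach T r (stateRun ω)) ∂M.playMeasure σ ≤ ∑ s ∈ T, q s * g (r s) := by
  rw [integral_apply_weightedReach M σ hT]
  have h1 : ∑ s ∈ T, q s * g (r s) = g 0 + ∑ s ∈ T, q s * (g (r s) - g 0) := by
    simp_rw [mul_sub]
    rw [Finset.sum_sub_distrib, ← Finset.sum_mul, hq1]
    ring
  rw [h1, add_le_add_iff_left]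
  refine Finset.sum_le_sum fun s hs => ?_
  rcases hattr with hA | hr
  · have hsum : ∑ s ∈ T, M.reachProb σ {s} = 1 := by
      have h2 := integral_apply_weightedReach M σ hT (fun _ => 1) id
      have h3 : ∫ ω, id (weightedReach T (fun _ => 1) (stateRun ω)) ∂M.playMeasure σ = 1 := by
        rw [integral_congr_ae (g := fun _ => (1 : ℝ))]
        · simp
        · filter_upwards [hA 𝕄 σ] with ω hω
          simp [weightedReach, hω]
      rw [h3] at h2
      simpa using h2.symm
    have := (Finset.sum_eq_sum_iff_of_le hq).1 (hsum.trans hq1.symm) s hs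
    rw [this]
  · refine mul_le_mul_of_nonneg_right (hq s hs) (sub_nonneg.2 (hg ?_))
    exact_mod_cast hr s hs

theorem Satisfies.exists_isLPSolution (hT : M.Absorbing T) (hreach : M.MECsReach T)
    (hattr : M.AttractionAssumption T r) (hp : p ∈ Set.Ioo (0 : ℝ) 1) {e c : ℚ}
    {𝕄 : Type} [Countable 𝕄] {σ : M.Strategy 𝕄} (hσ : M.Satisfies σ T r p e c) :
    ∃ t ∈ r '' (T : Set S), ∃ (y : A → ℝ) (x xl : S → ℝ), M.IsLPSolution T r p e c t y x xl := by
  obtain ⟨q, hq0, hqT, hq1, ⟨y, hy0, hy⟩, hqρ⟩ := exists_flow_ge_reachProb hT hreach σ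
  obtain ⟨t, ht, xl, hxl0, hxlq, hxllt, hxlp⟩ := exists_quantile_split T r hq0 hq1 hp.1.le hp.2.le
  refine ⟨t, ht, y, q, xl, hy0, hq0, hxl0, fun s => ?_, hq1, fun s _ => hxllt s, fun s _ _ => hxlq s,
    hxlp, ?_, ?_⟩
  · have := hy s
    simp only [Pi.sub_apply] at this
    linarith
  · have h1 : p * c ≤ p * M.cvarReach σ T r p := mul_le_mul_of_nonneg_left hσ.2 hp.1.le
    rw [cvarReach, mul_condValueAtRisk (M.integrable_weightedReach σ hT r) hp.1.ne'] at h1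
    set v := valueAtRisk (M.playMeasure σ) p fun ω => weightedReach T r (stateRun ω)
    have h2 := integral_apply_weightedReach_le hT hattr σ hq1 hqρ
      (g := fun u => -max (v - u) 0) fun a b hab => neg_le_neg (max_le_max (by linarith) le_rfl)
    rw [integral_neg] at h2
    have h3 := le_sum_mul_of_sum_eq hq0 hxl0 hxlq hxlp v
    linarith
  · exact hσ.1.trans (integral_apply_weightedReach_le hT hattr σ hq1 hqρ monotone_id)

end ToLP

end MDP

namespace MDP

/-! ## From solutions of the linear program to memoryless strategies -/

section FromLP

variable {S A : Type*} (M : MDP S A) {T : Finset S} {r : S → ℚ} {p : ℝ}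

/-- There is a memoryless strategy that plays proportionally to a given flow. -/
theorem exists_proportional_strategy (y : A → ℝ) (hy : ∀ a, 0 ≤ y a) :
    ∃ σ : M.Strategy Unit, ∀ s, 0 < ∑ b ∈ M.Av s, y b →
      ∀ a ∈ M.Av s, (σ.next s () a).toReal = y a / ∑ b ∈ M.Av s, y b := by
  classical
  have h (s : S) : ∃ P : PMF A, P.support ⊆ ↑(M.Av s) ∧ (0 < ∑ b ∈ M.Av s, y b →
      ∀ a ∈ M.Av s, (P a).toReal = y a / ∑ b ∈ M.Av s, y b) := by
    by_cases hs : 0 < ∑ b ∈ M.Av s, y b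
    · have hsum : ∑ a ∈ M.Av s,
          (if a ∈ M.Av s then ENNReal.ofReal (y a / ∑ b ∈ M.Av s, y b) else 0) = 1 := by
        rw [Finset.sum_congr rfl fun a ha => if_pos ha,
          ← ENNReal.ofReal_sum_of_nonneg fun a _ => div_nonneg (hy a) hs.le, ← Finset.sum_div,
          div_self hs.ne', ENNReal.ofReal_one]
      refine ⟨PMF.ofFinset _ (M.Av s) hsum fun a ha => if_neg ha, fun a ha => ?_, fun _ a ha => ?_⟩
      · by_contra h'
        exact (PMF.mem_support_iff _ _).1 ha (if_neg h')
      · rw [PMF.ofFinset_apply, if_pos ha, ENNReal.toReal_ofReal (div_nonneg (hy a) hs.le)]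
    · obtain ⟨a, ha⟩ := M.av_nonempty s
      exact ⟨PMF.pure a, by simpa using ha, fun h => absurd h hs⟩
  choose P hP1 hP2 using h
  exact ⟨⟨fun _ _ _ => PMF.pure (), fun s _ => P s, PMF.pure (), fun s _ => hP1 s⟩, hP2⟩

variable {M}

theorem Absorbing.apply_eq_zero (hT : M.Absorbing T) {s s' : S} (hs : s ∈ T) {a : A}
    (ha : a ∈ M.Av s) (h : s' ≠ s) : M.Δ a s' = 0 := by
  have h1 := (PMF.apply_eq_one_iff _ _).1 (hT s hs a ha)
  by_contra h2
  exact h (by simpa [h1] using (PMF.mem_support_iff _ _).2 h2)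

variable [Fintype S] [Fintype A] {y : A → ℝ} {x : S → ℝ}

/-- The expected number of plays of an action outside the targets is bounded by the flow. -/
theorem sum_actProb_le (hT : M.Absorbing T) (hy : ∀ a, 0 ≤ y a)
    (hflow : ∀ s, ({M.s₀} : Set S).indicator 1 s + ∑ a, y a * (M.Δ a s).toReal =
      ∑ a ∈ M.Av s, y a + x s) (hx : ∀ s ∉ T, x s = 0) {σ : M.Strategy Unit}
    (hσ : ∀ s, 0 < ∑ b ∈ M.Av s, y b →
      ∀ a ∈ M.Av s, (σ.next s () a).toReal = y a / ∑ b ∈ M.Av s, y b) (n : ℕ) :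
    ∀ s ∉ T, ∀ a ∈ M.Av s, ∑ k ∈ Finset.range n, M.actProb σ k a ≤ y a := by
  induction n with
  | zero => intro s _ a _; simpa using hy a
  | succ n ih =>
    intro s hs a ha
    have hvisits : ∑ k ∈ Finset.range (n + 1), M.stateProb σ k s ≤ ∑ b ∈ M.Av s, y b := by
      rw [Finset.sum_range_succ']
      simp_rw [stateProb_succ]
      rw [Finset.sum_comm, stateProb_zero]
      have h1 := hflow s
      rw [hx s hs, add_zero] at h1
      rw [← h1, add_comm, add_le_add_iff_left]
      refine Finset.sum_le_sum fun b _ => ?_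
      rw [← Finset.sum_mul]
      obtain ⟨s', hs', -⟩ := M.av_partition b
      by_cases h : s' ∈ T
      · rw [hT.apply_eq_zero h hs' (by rintro rfl; exact hs h)]
        simp
      · exact mul_le_mul_of_nonneg_right (ih s' h b hs') ENNReal.toReal_nonneg
    rw [Finset.sum_congr rfl fun k _ => M.actProb_eq_of_memoryless σ k ha, ← Finset.sum_mul]
    rcases (Finset.sum_nonneg fun b (_ : b ∈ M.Av s) => hy b).eq_or_lt with h | h
    · rw [← h] at hvisits
      exact (mul_nonpos_of_nonpos_of_nonneg hvisits ENNReal.toReal_nonneg).trans (hy a)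
    · rw [hσ s h a ha]
      calc _ ≤ (∑ b ∈ M.Av s, y b) * (y a / ∑ b ∈ M.Av s, y b) :=
            mul_le_mul_of_nonneg_right hvisits (div_nonneg (hy a) h.le)
        _ = y a := mul_div_cancel₀ _ h.ne'

/-- A memoryless strategy that plays proportionally to a flow reaches each target with the
probability given by the flow. -/
theorem reachProb_eq_of_flow (hT : M.Absorbing T) (hy : ∀ a, 0 ≤ y a) (hx0 : ∀ s, 0 ≤ x s)
    (hflow : ∀ s, ({M.s₀} : Set S).indicator 1 s + ∑ a, y a * (M.Δ a s).toReal =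
      ∑ a ∈ M.Av s, y a + x s) (hx1 : ∑ s ∈ T, x s = 1) {σ : M.Strategy Unit}
    (hσ : ∀ s, 0 < ∑ b ∈ M.Av s, y b →
      ∀ a ∈ M.Av s, (σ.next s () a).toReal = y a / ∑ b ∈ M.Av s, y b) :
    ∀ s ∈ T, M.reachProb σ {s} = x s := by
  classical
  have hsplit (f : S → ℝ) : ∑ s, f s = ∑ s ∈ T, f s + ∑ s ∈ Tᶜ, f s :=
    (Finset.sum_add_sum_compl T f).symm
  have hx : ∀ s ∉ T, x s = 0 := by
    have h0 : ∑ s, (x s - ({M.s₀} : Set S).indicator 1 s) = 0 :=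
      sum_eq_zero_of_mem_flowCone (M := M) ⟨y, hy, fun s => by linarith [hflow s]⟩
    have h1 : ∑ s, ({M.s₀} : Set S).indicator (1 : S → ℝ) s = 1 := by
      simp [Set.indicator_apply]
    rw [Finset.sum_sub_distrib, h1, hsplit, hx1] at h0
    have h2 : ∑ s ∈ Tᶜ, x s = 0 := by linarith
    intro s hs
    exact (Finset.sum_eq_zero_iff_of_nonneg fun s _ => hx0 s).1 h2 s (Finset.mem_compl.2 hs)
  have hle := sum_actProb_le hT hy hflow hx hσ
  have hprob (n : ℕ) : ∀ s ∈ T, M.stateProb σ n s ≤ x s := by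
    intro s hs
    have h1 := M.stateProb_sub_eq σ n s
    have h2 : ∑ a, (∑ k ∈ Finset.range n, M.actProb σ k a) *
        ((M.Δ a s).toReal - if a ∈ M.Av s then 1 else 0) ≤
        ∑ a, y a * ((M.Δ a s).toReal - if a ∈ M.Av s then 1 else 0) := by
      refine Finset.sum_le_sum fun a _ => ?_
      obtain ⟨s', hs', -⟩ := M.av_partition a
      by_cases h : s' = s
      · subst h
        simp [hs', hT s' hs a hs']
      · have ha : a ∉ M.Av s := fun h' => h (M.av_unique hs' h')
        by_cases h' : s' ∈ T
        · simp [ha, hT.apply_eq_zero h' hs' (Ne.symm h)]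
        · simp only [ha, if_false, sub_zero]
          exact mul_le_mul_of_nonneg_right (hle n s' h' a hs') ENNReal.toReal_nonneg
    rw [← h1, sum_mul_sub_ite] at h2
    linarith [hflow s]
  have hlim : ∀ s ∉ T, Filter.Tendsto (fun n => M.stateProb σ n s) Filter.atTop (nhds 0) := by
    intro s hs
    refine (summable_of_sum_range_le (c := ∑ a ∈ M.Av s, y a) (M.stateProb_nonneg σ · s)
      fun n => ?_).tendsto_atTop_zero
    simp_rw [stateProb_eq_sum_actProb]
    rw [Finset.sum_comm]
    exact Finset.sum_le_sum fun a ha => hle n s hs a ha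
  have hρle : ∀ s ∈ T, M.reachProb σ {s} ≤ x s := fun s hs =>
    le_of_tendsto' (M.tendsto_stateProb σ hT hs) fun n => hprob n s hs
  have hρ1 : ∑ s ∈ T, M.reachProb σ {s} = 1 := by
    have h1 : Filter.Tendsto (fun n => ∑ s, M.stateProb σ n s) Filter.atTop
        (nhds (∑ s ∈ T, M.reachProb σ {s} + ∑ s ∈ Tᶜ, 0)) := by
      simp_rw [hsplit]
      exact (tendsto_finsetSum _ fun s hs => M.tendsto_stateProb σ hT hs).add
        (tendsto_finsetSum _ fun s hs => hlim s (Finset.mem_compl.1 hs))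
    simp only [sum_stateProb, Finset.sum_const_zero, add_zero] at h1
    exact tendsto_nhds_unique h1 tendsto_const_nhds
  exact (Finset.sum_eq_sum_iff_of_le hρle).1 (hρ1.trans hx1.symm)

theorem IsLPSolution.exists_strategy (hT : M.Absorbing T) (hp : p ∈ Set.Ioo (0 : ℝ) 1) {e c t : ℚ}
    {xl : S → ℝ} (h : M.IsLPSolution T r p e c t y x xl) :
    ∃ σ : M.Strategy Unit, σ.InducedBy T y x ∧
      M.Satisfies σ T r p e c ∧ (t : ℝ) ≤ M.varReach σ T r p := by
  classical
  obtain ⟨σ, hσ⟩ := M.exists_proportional_strategy y h.y_nonneg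
  have hρ := reachProb_eq_of_flow hT h.y_nonneg h.x_nonneg h.flow h.switch hσ
  set P := M.playMeasure σ
  set X : (ℕ → PlayState S Unit A) → ℝ := fun ω => weightedReach T r (stateRun ω) with hX
  have hXi : Integrable X P := M.integrable_weightedReach σ hT r
  have hlaw (g : ℝ → ℝ) : ∫ ω, g (X ω) ∂P = ∑ s ∈ T, x s * g (r s) := by
    rw [hX, integral_apply_weightedReach M σ hT, Finset.sum_congr rfl fun s hs => by rw [hρ s hs]]
    simp_rw [mul_sub]
    rw [Finset.sum_sub_distrib, ← Finset.sum_mul, h.switch]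
    ring
  have hcdf (u : ℝ) : P.real {ω | X ω ≤ u} = ∑ s ∈ T with (r s : ℝ) ≤ u, x s := by
    have h1 := measureReal_mem_eq_integral_indicator hXi.aemeasurable (measurableSet_Iic (a := u))
    rw [hlaw] at h1
    rw [Finset.sum_filter]
    refine h1.trans (Finset.sum_congr rfl fun s _ => ?_)
    simp [Set.indicator_apply]
  set V : Set ℝ := {u | P.real {ω | X ω ≤ u} ≤ p}
  have hmono {T₁ T₂ : Finset S} (h12 : T₁ ⊆ T₂) : ∑ s ∈ T₁, x s ≤ ∑ s ∈ T₂, x s :=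
    Finset.sum_le_sum_of_subset_of_nonneg h12 fun s _ _ => h.x_nonneg s
  have hVlt : ∀ u : ℝ, u < t → u ∈ V := by
    intro u hu
    change _ ≤ p
    rw [hcdf]
    have hlt : ∀ s, (r s : ℝ) ≤ u → r s < t := fun s hs => by exact_mod_cast hs.trans_lt hu
    calc _ = ∑ s ∈ T with (r s : ℝ) ≤ u, xl s := Finset.sum_congr rfl fun s hs => by
            rw [Finset.mem_filter] at hs
            exact (h.split_lt s hs.1 (hlt s hs.2)).symm
      _ ≤ ∑ s ∈ T with r s ≤ t, xl s :=
          Finset.sum_le_sum_of_subset_of_nonneg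
            (Finset.monotone_filter_right _ fun s _ hs => (hlt s hs).le)
            fun s _ _ => h.xl_nonneg s
      _ = p := h.prob_split
  have hVb : BddAbove V := by
    refine ⟨∑ s ∈ T, |(r s : ℝ)|, fun u hu => ?_⟩
    by_contra! hlt
    have h1 : P.real {ω | X ω ≤ u} = 1 := by
      rw [hcdf, Finset.filter_true_of_mem, h.switch]
      intro s hs
      exact (le_abs_self _).trans ((Finset.single_le_sum (f := fun s => |(r s : ℝ)|)
        (fun s _ => abs_nonneg _) hs).trans hlt.le)
    exact absurd (h1 ▸ hu : (1 : ℝ) ≤ p) (not_le.2 hp.2)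
  set v := valueAtRisk P p X with hv
  have hvV : v = sSup V := rfl
  have htv : (t : ℝ) ≤ v := le_of_forall_lt_imp_le_of_dense fun u hu => le_csSup hVb (hVlt u hu)
  have hQ : ∑ s ∈ T with (r s : ℝ) < v, x s ≤ p := by
    rcases (T.filter fun s => (r s : ℝ) < v).eq_empty_or_nonempty with h0 | hne
    · rw [h0, Finset.sum_empty]
      exact hp.1.le
    · obtain ⟨w, hw, hmax⟩ := Finset.exists_max_image _ r hne
      obtain ⟨u, hu, hwu⟩ := exists_lt_of_lt_csSup (s := V) (b := (r w : ℝ))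
        ⟨(t : ℝ) - 1, hVlt _ (by linarith)⟩ (hvV ▸ (Finset.mem_filter.1 hw).2)
      refine le_trans (hmono fun s hs => ?_) ((hcdf u).ge.trans hu)
      refine Finset.mem_filter.2 ⟨(Finset.mem_filter.1 hs).1, le_trans ?_ hwu.le⟩
      exact_mod_cast hmax s hs
  refine ⟨σ, ⟨hσ, hρ⟩, ⟨?_, ?_⟩, htv⟩
  · exact h.exp.trans (hlaw id).ge
  · rw [← mul_le_mul_iff_right₀ hp.1, cvarReach, mul_condValueAtRisk hXi hp.1.ne', ← hv]
    rw [hlaw fun u => max (v - u) 0]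
    refine h.cvar.trans ?_
    have hterm : ∀ s ∈ T, x s * max (v - r s) 0 - (if r s ≤ t then xl s * (v - r s) else 0) ≤
        (v - t) * ((if (r s : ℝ) < v then x s else 0) - if r s ≤ t then xl s else 0) := by
      intro s hs
      rcases lt_trichotomy (r s) t with hlt | heq | hgt
      · have h1 : (r s : ℝ) < t := by exact_mod_cast hlt
        have h2 : (r s : ℝ) < v := h1.trans_le htv
        rw [if_pos hlt.le, if_pos hlt.le, if_pos h2, h.split_lt s hs hlt,
          max_eq_left (by linarith)]
        linarith
      · rw [if_pos heq.le, if_pos heq.le, heq, max_eq_left (by linarith)]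
        rcases htv.eq_or_lt with h1 | h1
        · simp [← h1]
        · rw [if_pos h1]
          linarith
      · have h1 : (t : ℝ) < r s := by exact_mod_cast hgt
        rw [if_neg hgt.not_ge, if_neg hgt.not_ge]
        split_ifs with h2
        · rw [max_eq_left (by linarith)]
          nlinarith [h.x_nonneg s]
        · rw [max_eq_right (by linarith)]
          simp
    have hsum := Finset.sum_le_sum hterm
    rw [← Finset.mul_sum, Finset.sum_sub_distrib, Finset.sum_sub_distrib, ← Finset.sum_filter,
      ← Finset.sum_filter, ← Finset.sum_filter, h.prob_split] at hsum
    simp_rw [mul_sub (xl _)] at hsum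
    rw [Finset.sum_sub_distrib, ← Finset.sum_mul, h.prob_split] at hsum
    have := mul_nonpos_of_nonneg_of_nonpos (sub_nonneg.2 htv) (sub_nonpos.2 hQ)
    linarith

end FromLP

end MDP

theorem mainTheorem7 {S A : Type*} [Fintype S] [Fintype A] (M : MDP S A)
    (T : Finset S) (r : S → ℚ) (hT : M.Absorbing T) (hreach : M.MECsReach T)
    (hattr : M.AttractionAssumption T r)
    (p : ℝ) (hp : p ∈ Set.Ioo (0 : ℝ) 1) (e c : ℚ) :
    (∀ (𝕄 : Type) [Countable 𝕄] (σ : M.Strategy 𝕄), M.Satisfies σ T r p e c →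
      ∃ t ∈ r '' (T : Set S), ∃ (y : A → ℝ) (x xl : S → ℝ),
        M.IsLPSolution T r p e c t y x xl) ∧
    (∀ t ∈ Set.range r, ∀ (y : A → ℝ) (x xl : S → ℝ),
      M.IsLPSolution T r p e c t y x xl →
      ∃ σ : M.Strategy Unit, σ.InducedBy T y x ∧
        M.Satisfies σ T r p e c ∧ (t : ℝ) ≤ M.varReach σ T r p) :=
  ⟨fun _ _ _ hσ => hσ.exists_isLPSolution hT hreach hattr hp,
    fun _ _ _ _ _ h => h.exists_strategy hT hp⟩
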